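/- Let $\Gamma$ be a graph on a finite vertex set $V$ and let $B(\Gamma)$ be its graphical building set, i.e. the collection of all non-empty $S\subseteq V$ for which the induced subgraph $\Gamma|_S$ is connected. Its nestohedron is the Minkowski sum $P(\Gamma)=\sum_{S\in B(\Gamma)}\Delta_S\subset\mathbb R^V$, where $\Delta_S$ is the convex hull of the standard basis vectors $e_i$, $i\in S$. For an $n$-dimensional polytope $P$ with $f_i$ faces of dimension $i$ (so $f_n=1$), the $f$-polynomial is $f(P)(\alpha,t)=\sum_{i=0}^{n} f_i\,\alpha^{i}t^{\,n-i}\in\mathbb Q[\alpha,t]$. For $k\ge 1$ and $l\ge 0$ let $P_{k,l}=P(\Gamma_{k,l})$, where $\Gamma_{k,l}$ is the join of the complete graph on $k$ nodes and the graph with no edges on $l$ nodes (the disjoint union of the two graphs together with all edges between them), and put $$P_{f,\nabla,\because}(x,y)=\sum_{k\ge 1}\sum_{l\ge 0} f(P_{k,l})(\alpha,t)\,\frac{x^k}{k!}\frac{y^l}{l!}\in\mathbb Q[\alpha,t][[x,y]].$$ Let $\eta(z)=\dfrac{e^{\alpha z}-1}{\alpha}=\sum_{n\ge1}\alpha^{n-1}\dfrac{z^n}{n!}$.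 Then $1-t\,\eta(x+y)$ is invertible in $\mathbb Q[\alpha,t][[x,y]]$ and $$P_{f,\nabla,\because}(x,y)=e^{(\alpha+t)y}\,\frac{\eta(x)}{1-t\,\eta(x+y)} .$$ -/

import Mathlib

open scoped Pointwise

noncomputable section

/-- A building set on a finite vertex set `V`: a collection of nonempty subsets of `V` that
contains all singletons and contains the union of any two of its members that meet. -/
structure BuildingSet (V : Type*) [DecidableEq V] where
  sets : Finset (Finset V)
  nonempty_of_mem : ∀ S ∈ sets, S.Nonempty
  singleton_mem : ∀ v : V, {v} ∈ sets
  union_mem : ∀ S ∈ sets, ∀ T ∈ sets, (S ∩ T).Nonempty → S ∪ T ∈ sets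

open scoped Classical in
/-- The graphical building set `B(G)`: all nonempty `S ⊆ V` whose induced graph is connected.
(`SimpleGraph.Connected` includes nonemptiness.) -/
def graphicalBuildingSet {V : Type*} [Fintype V] [DecidableEq V] (G : SimpleGraph V) :
    BuildingSet V where
  sets := Finset.univ.filter fun S : Finset V => (G.induce (S : Set V)).Connected
  nonempty_of_mem := by
    intro S hS
    obtain ⟨v, hv⟩ := (Finset.mem_filter.1 hS).2.nonempty
    exact ⟨v, hv⟩
  singleton_mem := by
    intro v
    refine Finset.mem_filter.2 ⟨Finset.mem_univ _, ?_⟩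
    rw [Finset.coe_singleton]
    exact { preconnected := SimpleGraph.Preconnected.of_subsingleton, nonempty := ⟨⟨v, rfl⟩⟩ }
  union_mem := by
    intro S hS T hT hST
    refine Finset.mem_filter.2 ⟨Finset.mem_univ _, ?_⟩
    rw [Finset.coe_union]
    have hS' := (Finset.mem_filter.1 hS).2
    have hT' := (Finset.mem_filter.1 hT).2
    refine SimpleGraph.induce_union_connected hS'.preconnected hT'.preconnected ?_
    rw [← Finset.coe_inter]
    exact_mod_cast hST

/-- `Δ_S`, the convex hull of the standard basis vectors `e_i`, `i ∈ S`, in `ℝ^V`. -/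
def simplexFace {V : Type*} [DecidableEq V] (S : Finset V) : Set (V → ℝ) :=
  convexHull ℝ ((fun i : V => (Pi.single i 1 : V → ℝ)) '' (S : Set V))

/-- The nestohedron `P_B`: the Minkowski sum of the simplices `Δ_S`, `S ∈ B`. -/
def nestohedron {V : Type*} [DecidableEq V] (B : BuildingSet V) : Set (V → ℝ) :=
  ∑ S ∈ B.sets, simplexFace S

/-- The dimension of (the affine hull of) a set. -/
def polyDim {E : Type*} [AddCommGroup E] [Module ℝ E] (P : Set E) : ℕ :=
  Module.finrank ℝ (vectorSpan ℝ P)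

/-- The number of `i`-dimensional nonempty faces of `P` (`P` itself is a face). A face is the set
of points of `P` at which some linear functional is maximal on `P`. -/
def faceCount {E : Type*} [AddCommGroup E] [Module ℝ E] [TopologicalSpace E]
    (P : Set E) (i : ℕ) : ℕ :=
  {F : Set E | F.Nonempty ∧ IsExposed ℝ P F ∧ polyDim F = i}.ncard

/-- The coefficient ring `ℚ[α, t]`. -/
abbrev CoeffRing : Type := MvPolynomial (Fin 2) ℚ

/-- The variable `α`. -/
def alphaVar : CoeffRing := MvPolynomial.X 0

/-- The variable `t`. -/
def tVar : CoeffRing := MvPolynomial.X 1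

/-- The `f`-polynomial `∑ f_i α^i t^(n-i)` of an `n`-dimensional polytope `P`, where `f_i` is the
number of `i`-dimensional faces. -/
def fPolynomial {E : Type*} [AddCommGroup E] [Module ℝ E] [TopologicalSpace E]
    (P : Set E) : CoeffRing :=
  ∑ i ∈ Finset.range (polyDim P + 1),
    (faceCount P i : CoeffRing) * alphaVar ^ i * tVar ^ (polyDim P - i)

/-- The join of two graphs: their disjoint union together with all edges between them. -/
def graphJoin {V W : Type*} (G : SimpleGraph V) (H : SimpleGraph W) : SimpleGraph (V ⊕ W) :=
  (G ⊕g H) ⊔ completeBipartiteGraph V W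

/-- The nestohedron of the join of the complete graph on `k` nodes and the empty graph on `l`
nodes. -/
def completeEmptyNestohedron (k l : ℕ) : Set (Fin k ⊕ Fin l → ℝ) :=
  nestohedron (graphicalBuildingSet
    (graphJoin (⊤ : SimpleGraph (Fin k)) (⊥ : SimpleGraph (Fin l))))

/-- The ring `ℚ[α, t][[x, y]]`. -/
abbrev SeriesRing : Type := MvPowerSeries (Fin 2) CoeffRing

/-- The variable `x`. -/
def xVar : SeriesRing := MvPowerSeries.X 0

/-- The variable `y`. -/
def yVar : SeriesRing := MvPowerSeries.X 1

/-- The generating function of the `f`-polynomials,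
`∑_{k ≥ 1} ∑_{l ≥ 0} f(P_{k,l}) x^k/k! y^l/l!`. -/
def fGenFun : SeriesRing := fun m : Fin 2 →₀ ℕ =>
  if m 0 = 0 then 0 else
    MvPolynomial.C (1 / ((m 0).factorial * (m 1).factorial : ℚ)) *
      fPolynomial (completeEmptyNestohedron (m 0) (m 1))

/-- The one-variable series `(e^{αz} - 1)/α = ∑_{n ≥ 1} α^(n-1) z^n/n!` over `ℚ[α, t]`. -/
def etaSeries : PowerSeries CoeffRing :=
  PowerSeries.mk fun n =>
    if n = 0 then 0 else MvPolynomial.C (1 / (n.factorial : ℚ)) * alphaVar ^ (n - 1)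

/-- `etaSeries` is the quotient `(e^{αz} - 1)/α` (unique, as `ℚ[α, t][[z]]` is a domain). -/
theorem alpha_mul_etaSeries :
    PowerSeries.C alphaVar * etaSeries =
      PowerSeries.rescale alphaVar (PowerSeries.exp CoeffRing) - 1 := by
  ext1 n
  rcases n with _ | n
  · rw [map_sub, PowerSeries.coeff_rescale, PowerSeries.coeff_exp, PowerSeries.coeff_C_mul]
    simp [etaSeries]
  · simp only [etaSeries, PowerSeries.coeff_C_mul, PowerSeries.coeff_mk, map_sub,
      PowerSeries.coeff_rescale, PowerSeries.coeff_exp, PowerSeries.coeff_one,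
      MvPolynomial.algebraMap_eq]
    simp only [Nat.succ_ne_zero, if_false, Nat.add_sub_cancel, sub_zero]
    ring

/-- `η(z) = (e^{αz} - 1)/α` at a series `z` with zero constant term. -/
def eta (z : SeriesRing) : SeriesRing := PowerSeries.subst z etaSeries

/-- `e^z` at a series `z` with zero constant term. -/
def expSeries (z : SeriesRing) : SeriesRing := PowerSeries.subst z (PowerSeries.exp CoeffRing)

end

/-! A face of the nestohedron is the set of maximizers of a weight `w`. Maximizing commutes with
Minkowski sums (`maximizers_sum`), and on `Δ_S` it gives the simplex on the part of `S` where `w` is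
largest (`maximizers_simplexFace`). So faces correspond bijectively to the maps `S ↦ topPart w S` on
the building set, and the dimension of a face is the rank of the differences `e_i - e_j` with `i, j`
in a common top part (`faceCount_nestohedron`).

Let `A` be a member of the building set and `C` its top part. Members of the building set inside `A`
that meet `C` have top part `S ∩ C`; the others lie in `A \ C`, where the choice is free. Hence the
faces with top part `C` are the faces of the restriction to `A \ C`, with dimension raised by `|C| -
1`. With weights `α^d t^(|A| - d)` this reads `F(A) = ∑_C α^(|C|-1) t F(A \ C)` over nonempty `C ⊆
A` (`facePolynomial_recursion`).

For the join, a set is in the building set iff it is a singleton or meets the complete part, so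
`F(A)` depends only on the numbers `k`, `l` of vertices of `A` in the two parts; it is `t^l` if `k =
0`, and `t f(P_{k,l})` otherwise. Writing `P` for the generating function, the exponential
generating function of `F` is `tP + e^{ty}`, and the recursion for `k ≥ 1` says `P = t η(x+y) P +
(η(x+y) - η(y)) e^{ty}`. Since `η(x+y) - η(y) = e^{αy} η(x)`, this is the claimed formula. The code
checks that the closed form satisfies the recursion coefficientwise
(`expCoeff_closedForm_recursion`), which determines it (`facePolynomial_eq`). -/

/-! ### Faces and directions of Minkowski sums. -/

section Minkowski

variable {ι E : Type*} [AddCommGroup E] [Module ℝ E]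

/-- The points of `P` at which the functional `l` is maximal on `P`. -/
def maximizers (l : E →ₗ[ℝ] ℝ) (P : Set E) : Set E :=
  {x ∈ P | ∀ y ∈ P, l y ≤ l x}

/-- Exchanging the single summand `g i` for another point of `s i` cannot increase `l` on the sum.
-/
theorem mem_maximizers_of_sum_mem [DecidableEq ι] {l : E →ₗ[ℝ] ℝ} {B : Finset ι} {s : ι → Set E}
    {g : ι → E} (hg : ∀ i ∈ B, g i ∈ s i) (h : ∑ i ∈ B, g i ∈ maximizers l (∑ i ∈ B, s i))
    {i : ι} (hi : i ∈ B) : g i ∈ maximizers l (s i) := by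
  refine ⟨hg i hi, fun y hy => ?_⟩
  have h1 := h.2 (∑ j ∈ B, Function.update g i y j) <| by
    refine Set.finsetSum_mem_finsetSum _ _ _ fun j hj => ?_
    by_cases hji : j = i
    · subst hji; simpa using hy
    · simpa [hji] using hg j hj
  rw [Finset.sum_update_of_mem hi, ← Finset.add_sum_erase _ _ hi, map_add, map_add,
    Finset.sdiff_singleton_eq_erase] at h1
  linarith

theorem maximizers_sum [DecidableEq ι] (l : E →ₗ[ℝ] ℝ) (B : Finset ι) (s : ι → Set E) :
    maximizers l (∑ i ∈ B, s i) = ∑ i ∈ B, maximizers l (s i) := by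
  ext x
  constructor
  · intro hx
    obtain ⟨g, hg, rfl⟩ := (Set.mem_finsetSum _ _ _).1 hx.1
    exact Set.finsetSum_mem_finsetSum _ _ _ fun i hi =>
      mem_maximizers_of_sum_mem (fun {i} hi => hg hi) hx hi
  · intro hx
    obtain ⟨g, hg, rfl⟩ := (Set.mem_finsetSum _ _ _).1 hx
    refine ⟨Set.finsetSum_mem_finsetSum _ _ _ fun i hi => (hg hi).1, fun y hy => ?_⟩
    obtain ⟨g', hg', rfl⟩ := (Set.mem_finsetSum _ _ _).1 hy
    rw [map_sum, map_sum]
    exact Finset.sum_le_sum fun i hi => (hg hi).2 _ (hg' hi)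

/-- A face of the sum remembers its summands: complete `x` by maximizers `g j` of the other summands
to a point of the common face. This is what makes the encoding of faces injective. -/
theorem maximizers_subset_of_sum_eq [DecidableEq ι] {l l' : E →ₗ[ℝ] ℝ} {B : Finset ι}
    {s : ι → Set E} (hne : ∀ i ∈ B, (maximizers l (s i)).Nonempty)
    (h : maximizers l (∑ i ∈ B, s i) = maximizers l' (∑ i ∈ B, s i)) {i : ι} (hi : i ∈ B) :
    maximizers l (s i) ⊆ maximizers l' (s i) := by
  intro x hx
  choose! g hg using hne
  have hmem : ∀ j ∈ B, Function.update g i x j ∈ maximizers l (s j) := by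
    intro j hj
    by_cases hji : j = i
    · subst hji; simpa using hx
    · simpa [hji] using hg j hj
  have h1 : ∑ j ∈ B, Function.update g i x j ∈ maximizers l' (∑ j ∈ B, s j) := by
    rw [← h, maximizers_sum]
    exact Set.finsetSum_mem_finsetSum _ _ _ hmem
  simpa using mem_maximizers_of_sum_mem (fun j hj => (hmem j hj).1) h1 hi

theorem vectorSpan_add_of_nonempty {s t : Set E} (hs : s.Nonempty) (ht : t.Nonempty) :
    vectorSpan ℝ (s + t) = vectorSpan ℝ s ⊔ vectorSpan ℝ t := by
  apply le_antisymm
  · rw [vectorSpan_def, Submodule.span_le]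
    rintro _ ⟨_, ⟨a, ha, b, hb, rfl⟩, _, ⟨c, hc, d, hd, rfl⟩, rfl⟩
    have h := Submodule.add_mem_sup (vsub_mem_vectorSpan ℝ ha hc) (vsub_mem_vectorSpan ℝ hb hd)
    simpa [add_sub_add_comm] using h
  · refine sup_le ?_ ?_ <;> rw [vectorSpan_def, Submodule.span_le]
    · obtain ⟨b, hb⟩ := ht
      rintro _ ⟨a, ha, c, hc, rfl⟩
      simpa using vsub_mem_vectorSpan ℝ (Set.add_mem_add ha hb) (Set.add_mem_add hc hb)
    · obtain ⟨b, hb⟩ := hs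
      rintro _ ⟨a, ha, c, hc, rfl⟩
      simpa using vsub_mem_vectorSpan ℝ (Set.add_mem_add hb ha) (Set.add_mem_add hb hc)

theorem finsetSum_nonempty {ι E : Type*} [AddCommGroup E] {B : Finset ι} {s : ι → Set E} (hs : ∀ i ∈ B, (s i).Nonempty) :
    (∑ i ∈ B, s i).Nonempty := by
  choose! g hg using hs
  exact ⟨_, Set.finsetSum_mem_finsetSum _ _ g hg⟩

theorem vectorSpan_sum_of_nonempty (B : Finset ι) {s : ι → Set E}
    (hs : ∀ i ∈ B, (s i).Nonempty) :
    vectorSpan ℝ (∑ i ∈ B, s i) = ⨆ i ∈ B, vectorSpan ℝ (s i) := by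
  classical
  induction B using Finset.induction_on with
  | empty =>
    simpa using vectorSpan_of_subsingleton ℝ (s := (0 : Set E)) Set.subsingleton_singleton
  | insert a B ha ih =>
    have hB : ∀ i ∈ B, (s i).Nonempty := fun i hi => hs i (Finset.mem_insert_of_mem hi)
    rw [Finset.sum_insert ha, vectorSpan_add_of_nonempty (hs a (Finset.mem_insert_self _ _))
      (finsetSum_nonempty hB), ih hB, Finset.iSup_insert]

end Minkowski

/-! ### Top parts of sets and faces of simplices. -/

section TopPart

variable {V : Type*}

open scoped Classical in
/-- The elements of `S` at which the weight `w` is maximal on `S`. -/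
noncomputable def topPart (w : V → ℝ) (S : Finset V) : Finset V :=
  S.filter fun i => ∀ j ∈ S, w j ≤ w i

theorem mem_topPart {w : V → ℝ} {S : Finset V} {i : V} :
    i ∈ topPart w S ↔ i ∈ S ∧ ∀ j ∈ S, w j ≤ w i := by
  simp [topPart]

theorem topPart_subset (w : V → ℝ) (S : Finset V) : topPart w S ⊆ S :=
  fun _ h => (mem_topPart.1 h).1

theorem topPart_nonempty (w : V → ℝ) {S : Finset V} (hS : S.Nonempty) : (topPart w S).Nonempty := by
  obtain ⟨i, hi, h⟩ := S.exists_max_image w hS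
  exact ⟨i, mem_topPart.2 ⟨hi, h⟩⟩

end TopPart

section Simplex

variable {V : Type*} [Fintype V]

/-- The functional `x ↦ ∑ i, w i * x i`. -/
def weightFunctional (w : V → ℝ) : (V → ℝ) →ₗ[ℝ] ℝ := Fintype.linearCombination ℝ w

theorem weightFunctional_apply (w x : V → ℝ) : weightFunctional w x = ∑ i, x i * w i := by
  simp [weightFunctional, Fintype.linearCombination_apply]

variable [DecidableEq V]

theorem mem_simplexFace {S : Finset V} {x : V → ℝ} :
    x ∈ simplexFace S ↔ (∀ i, 0 ≤ x i) ∧ ∑ i, x i = 1 ∧ ∀ i ∉ S, x i = 0 := by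
  constructor
  · intro hx
    have hconv : Convex ℝ {x : V → ℝ | (∀ i, 0 ≤ x i) ∧ ∑ i, x i = 1 ∧ ∀ i ∉ S, x i = 0} := by
      rintro x ⟨h1, h2, h3⟩ y ⟨h1', h2', h3'⟩ a b ha hb hab
      refine ⟨fun i => ?_, ?_, fun i hi => ?_⟩
      · have := mul_nonneg ha (h1 i)
        have := mul_nonneg hb (h1' i)
        simp only [Pi.add_apply, Pi.smul_apply, smul_eq_mul]
        positivity
      · simp [Finset.sum_add_distrib, ← Finset.mul_sum, h2, h2', hab]
      · simp [h3 i hi, h3' i hi]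
    refine convexHull_min ?_ hconv hx
    rintro _ ⟨i, hi, rfl⟩
    refine ⟨fun j => ?_, by simp, fun j hj => ?_⟩
    · by_cases h : j = i
      · subst h; simp
      · simp [h]
    · have : j ≠ i := fun h => hj (h ▸ hi)
      simp [this]
  · rintro ⟨h1, h2, h3⟩
    have hx : x = ∑ i ∈ S, x i • (Pi.single i 1 : V → ℝ) := by
      ext j
      by_cases hj : j ∈ S
      · simp [Finset.sum_apply, Pi.single_apply, hj]
      · simp [Finset.sum_apply, Pi.single_apply, hj, h3 j hj]
    rw [hx]
    refine (convex_convexHull ℝ _).sum_mem (fun i _ => h1 i) ?_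
      fun i hi => subset_convexHull ℝ _ ⟨i, hi, rfl⟩
    rw [← h2]
    exact Finset.sum_subset (Finset.subset_univ _) fun i _ hi => h3 i hi

theorem single_mem_simplexFace {S : Finset V} {i : V} :
    (Pi.single i 1 : V → ℝ) ∈ simplexFace S ↔ i ∈ S := by
  refine ⟨fun h => ?_, fun h => subset_convexHull ℝ _ ⟨i, h, rfl⟩⟩
  by_contra hi
  simpa using (mem_simplexFace.1 h).2.2 i hi

theorem simplexFace_nonempty {S : Finset V} (hS : S.Nonempty) : (simplexFace S).Nonempty := by
  obtain ⟨i, hi⟩ := hS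
  exact ⟨_, single_mem_simplexFace.2 hi⟩

theorem simplexFace_injective : Function.Injective (simplexFace : Finset V → Set (V → ℝ)) := by
  intro S T h
  ext i
  rw [← single_mem_simplexFace, h, single_mem_simplexFace]

theorem weightFunctional_single (w : V → ℝ) (i : V) :
    weightFunctional w (Pi.single i 1) = w i := by
  simp [weightFunctional_apply, Pi.single_apply]

theorem exists_weightFunctional_eq (l : (V → ℝ) →ₗ[ℝ] ℝ) : ∃ w, l = weightFunctional w := by
  refine ⟨fun i => l (Pi.single i 1), ?_⟩
  refine LinearMap.pi_ext' fun i => LinearMap.ext_ring ?_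
  simp [weightFunctional_single]

theorem maximizers_simplexFace (w : V → ℝ) (S : Finset V) :
    maximizers (weightFunctional w) (simplexFace S) = simplexFace (topPart w S) := by
  ext x
  constructor
  · rintro ⟨hx, hmax⟩
    obtain ⟨h1, h2, h3⟩ := mem_simplexFace.1 hx
    refine mem_simplexFace.2 ⟨h1, h2, fun i hi => ?_⟩
    by_cases hiS : i ∈ S
    · obtain ⟨j, hj⟩ := topPart_nonempty w ⟨i, hiS⟩
      obtain ⟨hjS, hjmax⟩ := mem_topPart.1 hj
      have hlt : w i < w j := by
        by_contra hle
        exact hi (mem_topPart.2 ⟨hiS, fun k hk => (hjmax k hk).trans (not_lt.1 hle)⟩)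
      have hle := hmax _ (single_mem_simplexFace.2 hjS)
      rw [weightFunctional_single, weightFunctional_apply] at hle
      -- The coordinates of `x` sum to 1, so this sum is `w j` minus the value at `x`. Its terms are
      -- nonnegative, hence all vanish, and `w i < w j` forces `x i = 0`.
      have hzero : ∑ k, x k * (w j - w k) ≤ 0 := by
        simp only [mul_sub, Finset.sum_sub_distrib, ← Finset.sum_mul, h2]
        linarith
      have hnonneg : ∀ k ∈ Finset.univ, 0 ≤ x k * (w j - w k) := by
        intro k _
        by_cases hk : k ∈ S
        · exact mul_nonneg (h1 k) (sub_nonneg.2 (hjmax k hk))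
        · simp [h3 k hk]
      have := (Finset.sum_eq_zero_iff_of_nonneg hnonneg).1
        (le_antisymm hzero (Finset.sum_nonneg hnonneg)) i (Finset.mem_univ _)
      exact (mul_eq_zero.1 this).resolve_right (sub_pos.2 hlt).ne'
    · exact h3 i hiS
  · intro hx
    obtain ⟨h1, h2, h3⟩ := mem_simplexFace.1 hx
    refine ⟨mem_simplexFace.2 ⟨h1, h2, fun i hi => h3 i fun h => hi (topPart_subset w S h)⟩, ?_⟩
    intro y hy
    obtain ⟨h1', h2', h3'⟩ := mem_simplexFace.1 hy
    have hne : (topPart w S).Nonempty := by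
      by_contra h
      rw [Finset.not_nonempty_iff_eq_empty] at h
      simp [h] at h3
      simp [h3] at h2
    obtain ⟨j, hj⟩ := hne
    have hxj : weightFunctional w x = w j := by
      rw [weightFunctional_apply, ← one_mul (w j), ← h2, Finset.sum_mul]
      refine Finset.sum_congr rfl fun k _ => ?_
      by_cases hk : k ∈ topPart w S
      · rw [mem_topPart] at hj hk
        rw [le_antisymm (hj.2 k hk.1) (hk.2 j hj.1)]
      · simp [h3 k hk]
    rw [hxj, weightFunctional_apply, ← one_mul (w j), ← h2', Finset.sum_mul]
    refine Finset.sum_le_sum fun k _ => ?_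
    by_cases hk : k ∈ S
    · exact mul_le_mul_of_nonneg_left ((mem_topPart.1 hj).2 k hk) (h1' k)
    · simp [h3' k hk]

end Simplex

theorem vectorSpan_simplexFace {V : Type*} [DecidableEq V] (S : Finset V) :
    vectorSpan ℝ (simplexFace S) =
      vectorSpan ℝ ((fun i : V => (Pi.single i 1 : V → ℝ)) '' (S : Set V)) := by
  rw [simplexFace, ← direction_affineSpan, affineSpan_convexHull, direction_affineSpan]

/-! ### Faces of a nestohedron encoded by choice maps. -/

section Faces

variable {V : Type*} [Fintype V] [DecidableEq V]

/-- The linear span of the differences `e_i - e_j` with `i, j` in a common `T S`, `S ∈ B`. -/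
def faceSpan (B : Finset (Finset V)) (T : Finset V → Finset V) : Submodule ℝ (V → ℝ) :=
  ⨆ S ∈ B, vectorSpan ℝ ((fun i : V => (Pi.single i 1 : V → ℝ)) '' (T S : Set V))

theorem polyDim_sum_simplexFace {B : Finset (Finset V)} {T : Finset V → Finset V}
    (hT : ∀ S ∈ B, (T S).Nonempty) :
    polyDim (∑ S ∈ B, simplexFace (T S)) = Module.finrank ℝ (faceSpan B T) := by
  have h : vectorSpan ℝ (∑ S ∈ B, simplexFace (T S)) = faceSpan B T := by
    rw [vectorSpan_sum_of_nonempty B fun S hS => simplexFace_nonempty (hT S hS)]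
    exact biSup_congr fun S _ => vectorSpan_simplexFace (T S)
  rw [polyDim, h]

/-- The map sending `S ∈ B`, `S ⊆ A`, to the part of `S` where `w` is maximal, and all other
sets to `∅`. -/
noncomputable def choiceMap (B : Finset (Finset V)) (A : Finset V) (w : V → ℝ) (S : Finset V) : Finset V :=
  if S ∈ B ∧ S ⊆ A then topPart w S else ∅

/-- All maps `choiceMap B A w`. -/
noncomputable def choiceMaps (B : Finset (Finset V)) (A : Finset V) : Finset (Finset V → Finset V) :=
  (Set.toFinite (Set.range (choiceMap B A))).toFinset

theorem mem_choiceMaps {B : Finset (Finset V)} {A : Finset V} {f : Finset V → Finset V} :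
    f ∈ choiceMaps B A ↔ ∃ w, choiceMap B A w = f := by
  simp [choiceMaps]

theorem maximizers_nestohedron (B : BuildingSet V) (w : V → ℝ) :
    maximizers (weightFunctional w) (nestohedron B) =
      ∑ S ∈ B.sets, simplexFace (choiceMap B.sets Finset.univ w S) := by
  rw [nestohedron, maximizers_sum]
  refine Finset.sum_congr rfl fun S hS => ?_
  rw [maximizers_simplexFace, choiceMap, if_pos ⟨hS, Finset.subset_univ _⟩]

theorem choiceMap_nonempty (B : BuildingSet V) (w : V → ℝ) {S : Finset V} (hS : S ∈ B.sets) :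
    (choiceMap B.sets Finset.univ w S).Nonempty := by
  rw [choiceMap, if_pos ⟨hS, Finset.subset_univ _⟩]
  exact topPart_nonempty w (B.nonempty_of_mem S hS)

theorem maximizers_nestohedron_nonempty (B : BuildingSet V) (w : V → ℝ) :
    (maximizers (weightFunctional w) (nestohedron B)).Nonempty := by
  rw [maximizers_nestohedron]
  exact finsetSum_nonempty fun S hS => simplexFace_nonempty (choiceMap_nonempty B w hS)

/-- Equal faces have equal summands, and `Δ_S` determines `S`. Choice maps are `∅` off the building
set, so agreement on its members is equality of functions. -/
theorem choiceMap_eq_of_maximizers_eq (B : BuildingSet V) {w w' : V → ℝ}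
    (h : maximizers (weightFunctional w) (nestohedron B) =
      maximizers (weightFunctional w') (nestohedron B)) :
    choiceMap B.sets Finset.univ w = choiceMap B.sets Finset.univ w' := by
  have hne : ∀ w : V → ℝ, ∀ S ∈ B.sets,
      (maximizers (weightFunctional w) (simplexFace S)).Nonempty := fun w S hS => by
    rw [maximizers_simplexFace]
    exact simplexFace_nonempty (topPart_nonempty w (B.nonempty_of_mem S hS))
  funext S
  by_cases hS : S ∈ B.sets
  · have := (maximizers_subset_of_sum_eq (hne w) h hS).antisymm
      (maximizers_subset_of_sum_eq (hne w') h.symm hS)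
    rw [maximizers_simplexFace, maximizers_simplexFace] at this
    simpa [choiceMap, hS] using simplexFace_injective this
  · simp [choiceMap, hS]

theorem isExposed_nestohedron_iff (B : BuildingSet V) (F : Set (V → ℝ)) :
    (F.Nonempty ∧ IsExposed ℝ (nestohedron B) F) ↔
      ∃ f ∈ choiceMaps B.sets Finset.univ, ∑ S ∈ B.sets, simplexFace (f S) = F := by
  constructor
  · rintro ⟨hne, hF⟩
    obtain ⟨l, rfl⟩ := hF hne
    obtain ⟨w, hw⟩ := exists_weightFunctional_eq (l : (V → ℝ) →ₗ[ℝ] ℝ)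
    refine ⟨_, mem_choiceMaps.2 ⟨w, rfl⟩, ?_⟩
    rw [← maximizers_nestohedron, ← hw]
    rfl
  · rintro ⟨f, hf, rfl⟩
    obtain ⟨w, rfl⟩ := mem_choiceMaps.1 hf
    rw [← maximizers_nestohedron]
    exact ⟨maximizers_nestohedron_nonempty B w, fun _ =>
      ⟨LinearMap.toContinuousLinearMap (weightFunctional w), rfl⟩⟩

theorem faceCount_nestohedron (B : BuildingSet V) (i : ℕ) :
    faceCount (nestohedron B) i =
      ((choiceMaps B.sets Finset.univ).filter
        fun f => Module.finrank ℝ (faceSpan B.sets f) = i).card := by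
  have hdim : ∀ f ∈ choiceMaps B.sets Finset.univ,
      polyDim (∑ S ∈ B.sets, simplexFace (f S)) = Module.finrank ℝ (faceSpan B.sets f) := by
    intro f hf
    obtain ⟨w, rfl⟩ := mem_choiceMaps.1 hf
    exact polyDim_sum_simplexFace fun S hS => choiceMap_nonempty B w hS
  have himage : {F : Set (V → ℝ) | F.Nonempty ∧ IsExposed ℝ (nestohedron B) F ∧ polyDim F = i} =
      (fun f : Finset V → Finset V => ∑ S ∈ B.sets, simplexFace (f S)) ''
        ((choiceMaps B.sets Finset.univ).filter
          fun f => Module.finrank ℝ (faceSpan B.sets f) = i : Finset _) := by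
    ext F
    rw [Set.mem_ofPred_eq, ← and_assoc, isExposed_nestohedron_iff]
    constructor
    · rintro ⟨⟨f, hf, rfl⟩, hi⟩
      exact ⟨f, Finset.mem_coe.2 (Finset.mem_filter.2 ⟨hf, (hdim f hf).symm.trans hi⟩), rfl⟩
    · rintro ⟨f, hf, rfl⟩
      obtain ⟨hf, hi⟩ := Finset.mem_filter.1 (Finset.mem_coe.1 hf)
      exact ⟨⟨f, hf, rfl⟩, (hdim f hf).trans hi⟩
  rw [faceCount, himage, Set.InjOn.ncard_image, Set.ncard_coe_finset]
  intro f hf g hg hfg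
  obtain ⟨w, rfl⟩ := mem_choiceMaps.1 (Finset.mem_filter.1 (Finset.mem_coe.1 hf)).1
  obtain ⟨w', rfl⟩ := mem_choiceMaps.1 (Finset.mem_filter.1 (Finset.mem_coe.1 hg)).1
  apply choiceMap_eq_of_maximizers_eq
  rwa [maximizers_nestohedron, maximizers_nestohedron]

end Faces

/-! ### The recursion obtained by removing the top part. -/

section Recursion

variable {V : Type*} [DecidableEq V]

theorem topPart_eq_inter {w : V → ℝ} {S A : Finset V} (hSA : S ⊆ A)
    (h : (S ∩ topPart w A).Nonempty) : topPart w S = S ∩ topPart w A := by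
  obtain ⟨i, hi⟩ := h
  obtain ⟨hiS, hi⟩ := Finset.mem_inter.1 hi
  have hiA := (mem_topPart.1 hi).2
  ext j
  rw [mem_topPart, Finset.mem_inter, mem_topPart]
  exact ⟨fun ⟨hj, hmax⟩ => ⟨hj, hSA hj, fun k hk => (hiA k hk).trans (hmax i hiS)⟩,
    fun ⟨hj, _, hmax⟩ => ⟨hj, fun k hk => hmax k (hSA hk)⟩⟩

theorem exists_topPart_eq (w : V → ℝ) {A C : Finset V} (hCA : C ⊆ A)
    (hC : C.Nonempty) :
    ∃ w' : V → ℝ, topPart w' A = C ∧ ∀ S ⊆ A \ C, topPart w' S = topPart w S := by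
  -- `M` exceeds every weight on `A`; raising `C` to the constant level `M` makes it the top part
  -- and leaves the weights off `C` alone.
  set M : ℝ := ∑ i ∈ A, |w i| + 1 with hM
  have hlt : ∀ i ∈ A, w i < M := fun i hi => by
    have h := Finset.single_le_sum (f := fun i => |w i|) (fun i _ => abs_nonneg _) hi
    have h' := le_abs_self (w i)
    linarith [h, h']
  refine ⟨fun i => if i ∈ C then M else w i, ?_, fun S hS => ?_⟩
  · ext i
    rw [mem_topPart]
    refine ⟨fun ⟨hi, hmax⟩ => ?_, fun hi => ⟨hCA hi, fun j hj => ?_⟩⟩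
    · by_contra hiC
      obtain ⟨j, hj⟩ := hC
      have := hmax j (hCA hj)
      simp only [hj, hiC, if_true, if_false] at this
      exact absurd (hlt i hi) (not_lt.2 this)
    · simp only [hi, if_true]
      split_ifs
      exacts [le_rfl, (hlt j hj).le]
  · have hnot : ∀ i ∈ S, i ∉ C := fun i hi => (Finset.mem_sdiff.1 (hS hi)).2
    ext i
    rw [mem_topPart, mem_topPart]
    refine and_congr_right fun hi => forall₂_congr fun j hj => ?_
    rw [if_neg (hnot i hi), if_neg (hnot j hj)]

/-- The map `f`, replaced by `∅` on the sets not contained in `A`. -/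
def restrictMap (A : Finset V) (f : Finset V → Finset V) (S : Finset V) : Finset V :=
  if S ⊆ A then f S else ∅

theorem restrictMap_choiceMap {B : Finset (Finset V)} {A A' : Finset V} (h : A' ⊆ A) (w : V → ℝ) :
    restrictMap A' (choiceMap B A w) = choiceMap B A' w := by
  funext S
  by_cases hS : S ⊆ A'
  · simp [restrictMap, choiceMap, hS, hS.trans h]
  · simp [restrictMap, choiceMap, hS]

theorem choiceMap_self {B : Finset (Finset V)} {A : Finset V} (hA : A ∈ B) (w : V → ℝ) :
    choiceMap B A w A = topPart w A := if_pos ⟨hA, subset_rfl⟩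

/-- The right side involves `w` only through the top part of `A` and the restriction to its
complement in `A`, so these two data determine the choice map. -/
theorem choiceMap_cases (B : Finset (Finset V)) (A : Finset V) (w : V → ℝ) (S : Finset V) :
    choiceMap B A w S =
      if S ⊆ A \ topPart w A then restrictMap (A \ topPart w A) (choiceMap B A w) S
      else if S ∈ B ∧ S ⊆ A then S ∩ topPart w A else ∅ := by
  by_cases h : S ⊆ A \ topPart w A
  · simp [restrictMap, h]
  · rw [if_neg h, choiceMap]
    split_ifs with hS
    · apply topPart_eq_inter hS.2
      by_contra hne
      rw [Finset.not_nonempty_iff_eq_empty, ← Finset.disjoint_iff_inter_eq_empty] at hne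
      exact h (Finset.subset_sdiff.2 ⟨hS.2, hne⟩)
    · rfl

theorem vectorSpan_single_le_span {S A : Finset V} (h : S ⊆ A) :
    vectorSpan ℝ ((fun i : V => (Pi.single i 1 : V → ℝ)) '' (S : Set V)) ≤
      Submodule.span ℝ ((fun i : V => (Pi.single i 1 : V → ℝ)) '' (A : Set V)) := by
  rw [vectorSpan_def, Submodule.span_le]
  rintro _ ⟨_, ⟨i, hi, rfl⟩, _, ⟨j, hj, rfl⟩, rfl⟩
  exact Submodule.sub_mem _ (Submodule.subset_span ⟨i, h hi, rfl⟩)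
    (Submodule.subset_span ⟨j, h hj, rfl⟩)

theorem vectorSpan_le_faceSpan {B : Finset (Finset V)} {T : Finset V → Finset V} {S C : Finset V}
    (hS : S ∈ B) (hC : C ⊆ T S) :
    vectorSpan ℝ ((fun i : V => (Pi.single i 1 : V → ℝ)) '' (C : Set V)) ≤ faceSpan B T :=
  (vectorSpan_mono ℝ (Set.image_mono (Finset.coe_subset.2 hC))).trans
    (le_iSup₂ (f := fun (S : Finset V) (_ : S ∈ B) =>
      vectorSpan ℝ ((fun i : V => (Pi.single i 1 : V → ℝ)) '' (T S : Set V))) S hS)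

theorem faceSpan_choiceMap_le (B : Finset (Finset V)) (A : Finset V) (w : V → ℝ) :
    faceSpan B (choiceMap B A w) ≤
      Submodule.span ℝ ((fun i : V => (Pi.single i 1 : V → ℝ)) '' (A : Set V)) := by
  refine iSup₂_le fun S _ => vectorSpan_single_le_span ?_
  rw [choiceMap]
  split_ifs with h
  exacts [(topPart_subset w S).trans h.2, Finset.empty_subset _]

/-- `C` splits into independent subsets of `A ∩ K` and `A \ K`; the binomials count those of given
sizes. -/
theorem sum_powerset_inter_sdiff {R : Type*} [CommSemiring R] (A K : Finset V)
    (φ : ℕ → ℕ → R) :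
    ∑ C ∈ A.powerset, φ (C ∩ K).card (C \ K).card =
      ∑ p ∈ Finset.range ((A ∩ K).card + 1), ∑ q ∈ Finset.range ((A \ K).card + 1),
        ((A ∩ K).card.choose p : R) * ((A \ K).card.choose q : R) * φ p q := by
  have h : ∑ C ∈ A.powerset, φ (C ∩ K).card (C \ K).card =
      ∑ X ∈ (A ∩ K).powerset ×ˢ (A \ K).powerset, φ X.1.card X.2.card := by
    refine Finset.sum_bij' (fun C _ => (C ∩ K, C \ K)) (fun X _ => X.1 ∪ X.2) ?_ ?_ ?_ ?_ ?_
    · intro C hC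
      rw [Finset.mem_powerset] at hC
      simp only [Finset.mem_product, Finset.mem_powerset]
      exact ⟨Finset.inter_subset_inter_right hC, Finset.sdiff_subset_sdiff hC subset_rfl⟩
    · rintro ⟨X, Y⟩ hXY
      simp only [Finset.mem_product, Finset.mem_powerset] at hXY ⊢
      exact Finset.union_subset (hXY.1.trans Finset.inter_subset_left)
        (hXY.2.trans Finset.sdiff_subset)
    · intro C _
      rw [Finset.union_comm]
      exact Finset.sdiff_union_inter C K
    · rintro ⟨X, Y⟩ hXY
      simp only [Finset.mem_product, Finset.mem_powerset] at hXY
      have hX : ∀ i ∈ X, i ∈ K := fun i hi => (Finset.mem_inter.1 (hXY.1 hi)).2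
      have hY : ∀ i ∈ Y, i ∉ K := fun i hi => (Finset.mem_sdiff.1 (hXY.2 hi)).2
      ext i <;> grind
    · intro C _
      rfl
  rw [h, Finset.sum_product, Finset.sum_powerset_apply_card
    (f := fun p => ∑ Y ∈ (A \ K).powerset, φ p Y.card)]
  refine Finset.sum_congr rfl fun p _ => ?_
  rw [Finset.sum_powerset_apply_card (f := φ p), Finset.smul_sum]
  refine Finset.sum_congr rfl fun q _ => ?_
  simp only [nsmul_eq_mul, mul_assoc]

theorem faceSpan_choiceMap {B : Finset (Finset V)} {A : Finset V} (hA : A ∈ B) (w : V → ℝ) :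
    faceSpan B (choiceMap B A w) =
      vectorSpan ℝ ((fun i : V => (Pi.single i 1 : V → ℝ)) '' (topPart w A : Set V)) ⊔
        faceSpan B (choiceMap B (A \ topPart w A) w) := by
  rw [← restrictMap_choiceMap (B := B) Finset.sdiff_subset w]
  apply le_antisymm
  · refine iSup₂_le fun S hS => ?_
    rw [choiceMap_cases]
    split_ifs with h1 h2
    · exact le_sup_of_le_right (vectorSpan_le_faceSpan hS subset_rfl)
    · exact le_sup_of_le_left
        (vectorSpan_mono ℝ (Set.image_mono (Finset.coe_subset.2 Finset.inter_subset_right)))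
    · simp [vectorSpan_empty]
  · refine sup_le ?_ (iSup₂_le fun S hS => ?_)
    · exact vectorSpan_le_faceSpan hA (choiceMap_self hA w).ge
    · refine vectorSpan_le_faceSpan hS ?_
      rw [restrictMap]
      split_ifs <;> simp

variable [Fintype V]

theorem finrank_faceSpan_choiceMap_le (B : Finset (Finset V)) (A : Finset V) (w : V → ℝ) :
    Module.finrank ℝ (faceSpan B (choiceMap B A w)) ≤ A.card := by
  refine (Submodule.finrank_mono (faceSpan_choiceMap_le B A w)).trans ?_
  rw [← Finset.coe_image]
  exact (finrank_span_finset_le_card _).trans Finset.card_image_le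

theorem linearIndependent_single : LinearIndependent ℝ fun i : V => (Pi.single i 1 : V → ℝ) := by
  convert (Pi.basisFun ℝ V).linearIndependent using 1
  ext i : 1
  simp

theorem finrank_vectorSpan_single {C : Finset V} (hC : C.Nonempty) :
    Module.finrank ℝ (vectorSpan ℝ ((fun i : V => (Pi.single i 1 : V → ℝ)) '' (C : Set V))) =
      C.card - 1 := by
  rw [← Finset.coe_image]
  exact linearIndependent_single.affineIndependent.finrank_vectorSpan_image_finset
    (Nat.succ_pred_eq_of_pos hC.card_pos).symm

/-- The two summands of `faceSpan_choiceMap` lie in the spans of basis vectors indexed by disjoint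
sets, so their ranks add. -/
theorem finrank_faceSpan_choiceMap {B : Finset (Finset V)} {A : Finset V} (hA : A ∈ B)
    (hne : A.Nonempty) (w : V → ℝ) :
    Module.finrank ℝ (faceSpan B (choiceMap B A w)) =
      (topPart w A).card - 1 +
        Module.finrank ℝ (faceSpan B (choiceMap B (A \ topPart w A) w)) := by
  have hdisj : Disjoint
      (vectorSpan ℝ ((fun i : V => (Pi.single i 1 : V → ℝ)) '' (topPart w A : Set V)))
      (faceSpan B (choiceMap B (A \ topPart w A) w)) := by
    refine Disjoint.mono (vectorSpan_single_le_span subset_rfl) (faceSpan_choiceMap_le _ _ _)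
      (linearIndependent_single.disjoint_span_image ?_)
    exact_mod_cast Finset.disjoint_sdiff
  have h := Submodule.finrank_sup_add_finrank_inf_eq
    (vectorSpan ℝ ((fun i : V => (Pi.single i 1 : V → ℝ)) '' (topPart w A : Set V)))
    (faceSpan B (choiceMap B (A \ topPart w A) w))
  rw [hdisj.eq_bot, finrank_bot, add_zero, ← faceSpan_choiceMap hA,
    finrank_vectorSpan_single (topPart_nonempty w hne)] at h
  exact h

/-- The sum of `α ^ d * t ^ (|A| - d)` over the faces of the nestohedron of the restriction of `B`
to `A`, where `d` is the dimension of the face. -/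
noncomputable def facePolynomial (B : Finset (Finset V)) (A : Finset V) : CoeffRing :=
  ∑ f ∈ choiceMaps B A, alphaVar ^ Module.finrank ℝ (faceSpan B f) *
    tVar ^ (A.card - Module.finrank ℝ (faceSpan B f))

theorem facePolynomial_recursion {B : Finset (Finset V)} {A : Finset V} (hA : A ∈ B)
    (hne : A.Nonempty) :
    facePolynomial B A = ∑ C ∈ A.powerset.filter Finset.Nonempty,
      alphaVar ^ (C.card - 1) * tVar * facePolynomial B (A \ C) := by
  have hmaps : ∀ f ∈ choiceMaps B A, f A ∈ A.powerset.filter Finset.Nonempty := by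
    intro f hf
    obtain ⟨w, rfl⟩ := mem_choiceMaps.1 hf
    rw [choiceMap_self hA, Finset.mem_filter, Finset.mem_powerset]
    exact ⟨topPart_subset w A, topPart_nonempty w hne⟩
  rw [facePolynomial, ← Finset.sum_fiberwise_of_maps_to hmaps]
  refine Finset.sum_congr rfl fun C hC => ?_
  obtain ⟨hCA, hC⟩ := Finset.mem_filter.1 hC
  rw [Finset.mem_powerset] at hCA
  rw [facePolynomial, Finset.mul_sum]
  refine Finset.sum_bij (fun f _ => restrictMap (A \ C) f) ?_ ?_ ?_ ?_
  · intro f hf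
    obtain ⟨w, rfl⟩ := mem_choiceMaps.1 (Finset.mem_filter.1 hf).1
    exact mem_choiceMaps.2 ⟨w, (restrictMap_choiceMap Finset.sdiff_subset w).symm⟩
  · intro f hf g hg hfg
    obtain ⟨hf, hfC⟩ := Finset.mem_filter.1 hf
    obtain ⟨hg, hgC⟩ := Finset.mem_filter.1 hg
    obtain ⟨w, rfl⟩ := mem_choiceMaps.1 hf
    obtain ⟨w', rfl⟩ := mem_choiceMaps.1 hg
    rw [choiceMap_self hA] at hfC hgC
    -- Injectivity: both maps are rebuilt by `choiceMap_cases` from the same `C` and the same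
    -- restriction.
    funext S
    rw [choiceMap_cases, choiceMap_cases B A w', hfC, hgC, hfg]
  · intro g hg
    obtain ⟨w, rfl⟩ := mem_choiceMaps.1 hg
    obtain ⟨w', hw', h⟩ := exists_topPart_eq w hCA hC
    refine ⟨choiceMap B A w', Finset.mem_filter.2 ⟨mem_choiceMaps.2 ⟨w', rfl⟩, ?_⟩, ?_⟩
    · rw [choiceMap_self hA, hw']
    · rw [restrictMap_choiceMap Finset.sdiff_subset]
      funext S
      simp only [choiceMap]
      split_ifs with hS
      exacts [h S hS.2, rfl]
  · intro f hf
    obtain ⟨hf, hfC⟩ := Finset.mem_filter.1 hf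
    obtain ⟨w, rfl⟩ := mem_choiceMaps.1 hf
    rw [choiceMap_self hA] at hfC
    have hle := finrank_faceSpan_choiceMap_le B (A \ C) w
    have hcard := Finset.card_sdiff_add_card_eq_card hCA
    have hpos := hC.card_pos
    rw [restrictMap_choiceMap Finset.sdiff_subset, finrank_faceSpan_choiceMap hA hne, hfC]
    -- No subtraction truncates, as `C` is nonempty and the rank is at most `|A \ C|`. The leading 1
    -- is the factor `t` of the recursion.
    have : A.card - (C.card - 1 + Module.finrank ℝ (faceSpan B (choiceMap B (A \ C) w))) =
        1 + ((A \ C).card - Module.finrank ℝ (faceSpan B (choiceMap B (A \ C) w))) := by omega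
    rw [this]
    ring

/-- A sum of simplices on singletons is a point: there is one choice map, of rank 0. -/
theorem facePolynomial_of_card_eq_one {B : Finset (Finset V)} {A : Finset V}
    (h : ∀ S ∈ B, S ⊆ A → S.card = 1) : facePolynomial B A = tVar ^ A.card := by
  have hmap : ∀ w : V → ℝ, choiceMap B A w = fun S => if S ∈ B ∧ S ⊆ A then S else ∅ := by
    intro w
    funext S
    rw [choiceMap]
    split_ifs with hS
    · obtain ⟨i, rfl⟩ := Finset.card_eq_one.1 (h S hS.1 hS.2)
      ext j
      simp +contextual [mem_topPart]
    · rfl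
  have hspan : faceSpan B (choiceMap B A 0) = ⊥ := by
    refine le_bot_iff.1 (iSup₂_le fun S hS => le_bot_iff.2 (vectorSpan_of_subsingleton ℝ ?_))
    apply Set.Subsingleton.image
    simp only [hmap]
    split_ifs with hSA
    · obtain ⟨i, rfl⟩ := Finset.card_eq_one.1 (h S hSA.1 hSA.2)
      simp
    · simp
  have hmaps : choiceMaps B A = {choiceMap B A 0} := by
    ext f
    rw [mem_choiceMaps, Finset.mem_singleton]
    exact ⟨fun ⟨w, hw⟩ => by rw [← hw, hmap, hmap], fun hf => ⟨0, hf.symm⟩⟩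
  rw [facePolynomial, hmaps, Finset.sum_singleton, hspan]
  simp

/-- Strong induction on `A`: if `A` meets `K` it belongs to `B` and the recursion applies; if not,
the members of `B` inside `A` are singletons. -/
theorem facePolynomial_eq {B : Finset (Finset V)} {K : Finset V}
    (hB : ∀ S, S ∈ B ↔ S.card = 1 ∨ (S ∩ K).Nonempty) {h : ℕ → ℕ → CoeffRing}
    (h_zero : ∀ l, h 0 l = tVar ^ l)
    (h_pos : ∀ k l, k ≠ 0 → h k l = ∑ p ∈ Finset.range (k + 1), ∑ q ∈ Finset.range (l + 1),
      (k.choose p : CoeffRing) * (l.choose q : CoeffRing) *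
        if p + q = 0 then 0 else alphaVar ^ (p + q - 1) * tVar * h (k - p) (l - q))
    (A : Finset V) : facePolynomial B A = h (A ∩ K).card (A \ K).card := by
  induction A using Finset.strongInduction with
  | H A ih =>
  by_cases hA : (A ∩ K).Nonempty
  · rw [facePolynomial_recursion ((hB A).2 (Or.inr hA)) (hA.mono Finset.inter_subset_left),
      h_pos _ _ hA.card_pos.ne', ← sum_powerset_inter_sdiff A K fun p q =>
        if p + q = 0 then 0 else
          alphaVar ^ (p + q - 1) * tVar * h ((A ∩ K).card - p) ((A \ K).card - q),
      Finset.sum_filter]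
    refine Finset.sum_congr rfl fun C hC => ?_
    rw [Finset.mem_powerset] at hC
    have hcard : (C ∩ K).card + (C \ K).card = C.card := Finset.card_inter_add_card_sdiff C K
    rw [hcard]
    by_cases hCne : C.Nonempty
    · have h1 : ((A \ C) ∩ K).card = (A ∩ K).card - (C ∩ K).card := by
        rw [← Finset.card_sdiff_of_subset (Finset.inter_subset_inter_right hC)]
        congr 1; ext; grind
      have h2 : ((A \ C) \ K).card = (A \ K).card - (C \ K).card := by
        rw [← Finset.card_sdiff_of_subset (Finset.sdiff_subset_sdiff hC subset_rfl)]
        congr 1; ext; grind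
      rw [if_pos hCne, if_neg hCne.card_pos.ne', ih _ (Finset.sdiff_ssubset hC hCne), h1, h2]
    · rw [if_neg hCne, if_pos]
      simpa [Finset.not_nonempty_iff_eq_empty] using hCne
  · have h0 : A ∩ K = ∅ := Finset.not_nonempty_iff_eq_empty.1 hA
    have hsd : A \ K = A := Finset.sdiff_eq_self_iff_disjoint.2
      (Finset.disjoint_iff_inter_eq_empty.2 h0)
    rw [h0, Finset.card_empty, h_zero, hsd]
    refine facePolynomial_of_card_eq_one fun S hS hSA => ((hB S).1 hS).resolve_right fun hSK => ?_
    exact hA (hSK.mono (Finset.inter_subset_inter_right hSA))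

end Recursion

/-! ### Exponential coefficients and the closed form. -/

section Series

/-- The exponent of the monomial `x ^ k * y ^ l`. -/
noncomputable def pairExponent (k l : ℕ) : Fin 2 →₀ ℕ := Finsupp.single 0 k + Finsupp.single 1 l

@[simp] theorem pairExponent_zero (k l : ℕ) : pairExponent k l 0 = k := by simp [pairExponent]

@[simp] theorem pairExponent_one (k l : ℕ) : pairExponent k l 1 = l := by simp [pairExponent]

theorem pairExponent_eta (m : Fin 2 →₀ ℕ) : pairExponent (m 0) (m 1) = m := by
  ext i
  fin_cases i <;> simp

theorem pairExponent_eq_iff {k l : ℕ} {m : Fin 2 →₀ ℕ} :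
    m = pairExponent k l ↔ m 0 = k ∧ m 1 = l := by
  refine ⟨fun h => by simp [h], fun ⟨h0, h1⟩ => ?_⟩
  rw [← h0, ← h1, pairExponent_eta]

theorem pow_mul_pow_eq_monomial (i j : ℕ) :
    xVar ^ i * yVar ^ j = MvPowerSeries.monomial (pairExponent i j) (1 : CoeffRing) := by
  rw [xVar, yVar, MvPowerSeries.X_pow_eq, MvPowerSeries.X_pow_eq,
    MvPowerSeries.monomial_mul_monomial, mul_one, pairExponent]

/-- The coefficient of `x^k/k! * y^l/l!`. -/
noncomputable def expCoeff (F : SeriesRing) (k l : ℕ) : CoeffRing :=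
  (k.factorial * l.factorial : CoeffRing) * MvPowerSeries.coeff (pairExponent k l) F

theorem expCoeff_add (F G : SeriesRing) (k l : ℕ) :
    expCoeff (F + G) k l = expCoeff F k l + expCoeff G k l := by
  simp [expCoeff, mul_add]

theorem expCoeff_C_mul (c : CoeffRing) (F : SeriesRing) (k l : ℕ) :
    expCoeff (MvPowerSeries.C c * F) k l = c * expCoeff F k l := by
  rw [expCoeff, expCoeff, MvPowerSeries.coeff_C_mul]
  ring

theorem ext_of_expCoeff {F G : SeriesRing} (h : ∀ k l, expCoeff F k l = expCoeff G k l) :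
    F = G := by
  ext1 m
  have hm := h (m 0) (m 1)
  rw [expCoeff, expCoeff, pairExponent_eta] at hm
  refine mul_left_cancel₀ (mul_ne_zero ?_ ?_) hm <;>
    exact_mod_cast Nat.factorial_ne_zero _

theorem coeff_mul_pairExponent (F G : SeriesRing) (k l : ℕ) :
    MvPowerSeries.coeff (pairExponent k l) (F * G) =
      ∑ p ∈ Finset.range (k + 1), ∑ q ∈ Finset.range (l + 1),
        MvPowerSeries.coeff (pairExponent p q) F *
          MvPowerSeries.coeff (pairExponent (k - p) (l - q)) G := by
  have h : ∑ u ∈ Finset.HasAntidiagonal.antidiagonal (pairExponent k l),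
      MvPowerSeries.coeff u.1 F * MvPowerSeries.coeff u.2 G =
      ∑ v ∈ Finset.HasAntidiagonal.antidiagonal k ×ˢ Finset.HasAntidiagonal.antidiagonal l,
        MvPowerSeries.coeff (pairExponent v.1.1 v.2.1) F *
          MvPowerSeries.coeff (pairExponent v.1.2 v.2.2) G := by
    refine Finset.sum_bij' (fun u _ => ((u.1 0, u.2 0), (u.1 1, u.2 1)))
      (fun v _ => (pairExponent v.1.1 v.2.1, pairExponent v.1.2 v.2.2)) ?_ ?_ ?_ ?_ ?_
    · intro u hu
      rw [Finset.HasAntidiagonal.mem_antidiagonal, pairExponent_eq_iff] at hu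
      simpa using hu
    · intro v hv
      rw [Finset.HasAntidiagonal.mem_antidiagonal, pairExponent_eq_iff]
      simpa using hv
    · intro u _
      simp [pairExponent_eta]
    · intro v _
      simp
    · intro u _
      simp [pairExponent_eta]
  rw [MvPowerSeries.coeff_mul, h, Finset.sum_product,
    Finset.Nat.sum_antidiagonal_eq_sum_range_succ_mk]
  refine Finset.sum_congr rfl fun p _ => ?_
  rw [Finset.Nat.sum_antidiagonal_eq_sum_range_succ_mk]

theorem expCoeff_mul (F G : SeriesRing) (k l : ℕ) :
    expCoeff (F * G) k l = ∑ p ∈ Finset.range (k + 1), ∑ q ∈ Finset.range (l + 1),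
      (k.choose p : CoeffRing) * (l.choose q : CoeffRing) *
        (expCoeff F p q * expCoeff G (k - p) (l - q)) := by
  rw [expCoeff, coeff_mul_pairExponent, Finset.mul_sum]
  refine Finset.sum_congr rfl fun p hp => ?_
  rw [Finset.mul_sum]
  refine Finset.sum_congr rfl fun q hq => ?_
  rw [← Nat.choose_mul_factorial_mul_factorial (Finset.mem_range_succ_iff.1 hp),
    ← Nat.choose_mul_factorial_mul_factorial (Finset.mem_range_succ_iff.1 hq), expCoeff, expCoeff]
  push_cast
  ring

theorem factorial_mul_C_one_div (n : ℕ) :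
    (n.factorial : CoeffRing) * MvPolynomial.C (1 / (n.factorial : ℚ)) = 1 := by
  rw [← map_natCast (MvPolynomial.C : ℚ →+* CoeffRing), ← map_mul,
    mul_one_div_cancel (by exact_mod_cast n.factorial_ne_zero), map_one]

theorem factorial_mul_coeff_etaSeries (n : ℕ) :
    (n.factorial : CoeffRing) * PowerSeries.coeff n etaSeries =
      if n = 0 then 0 else alphaVar ^ (n - 1) := by
  rw [etaSeries, PowerSeries.coeff_mk]
  split_ifs
  · rw [mul_zero]
  · rw [← mul_assoc, factorial_mul_C_one_div, one_mul]

theorem hasSubst_xVar : PowerSeries.HasSubst xVar :=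
  PowerSeries.HasSubst.of_constantCoeff_zero (by simp [xVar])

theorem hasSubst_C_mul_yVar (c : CoeffRing) : PowerSeries.HasSubst (MvPowerSeries.C c * yVar) :=
  PowerSeries.HasSubst.of_constantCoeff_zero (by simp [yVar])

theorem hasSubst_xVar_add_yVar : PowerSeries.HasSubst (xVar + yVar) :=
  PowerSeries.HasSubst.of_constantCoeff_zero (by simp [xVar, yVar])

theorem expCoeff_eta_xVar (k l : ℕ) :
    expCoeff (eta xVar) k l = if l = 0 ∧ k ≠ 0 then alphaVar ^ (k - 1) else 0 := by
  have hpow : ∀ d, xVar ^ d = MvPowerSeries.monomial (pairExponent d 0) (1 : CoeffRing) := by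
    intro d
    rw [← pow_mul_pow_eq_monomial, pow_zero, mul_one]
  have h : MvPowerSeries.coeff (pairExponent k l) (eta xVar) =
      if l = 0 then PowerSeries.coeff k etaSeries else 0 := by
    rw [eta, PowerSeries.coeff_subst hasSubst_xVar, finsum_eq_single _ k]
    · simp [hpow, MvPowerSeries.coeff_monomial, pairExponent_eq_iff]
    · intro d hd
      simp [hpow, MvPowerSeries.coeff_monomial, pairExponent_eq_iff, hd.symm]
  rw [expCoeff, h]
  by_cases hl : l = 0
  · simp [hl, factorial_mul_coeff_etaSeries, ite_not]
  · simp [hl]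

theorem expCoeff_expSeries (c : CoeffRing) (k l : ℕ) :
    expCoeff (expSeries (MvPowerSeries.C c * yVar)) k l = if k = 0 then c ^ l else 0 := by
  have hpow : ∀ d, MvPowerSeries.coeff (pairExponent k l) ((MvPowerSeries.C c * yVar) ^ d) =
      if k = 0 ∧ l = d then c ^ d else 0 := by
    intro d
    rw [mul_pow, ← map_pow, MvPowerSeries.coeff_C_mul, ← one_mul (yVar ^ d), ← pow_zero xVar,
      pow_mul_pow_eq_monomial, MvPowerSeries.coeff_monomial]
    simp [pairExponent_eq_iff]
  have h : MvPowerSeries.coeff (pairExponent k l) (expSeries (MvPowerSeries.C c * yVar)) =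
      if k = 0 then MvPolynomial.C (1 / (l.factorial : ℚ)) * c ^ l else 0 := by
    rw [expSeries, PowerSeries.coeff_subst (hasSubst_C_mul_yVar c), finsum_eq_single _ l]
    · simp [hpow, PowerSeries.coeff_exp, MvPolynomial.algebraMap_eq]
    · intro d hd
      simp [hpow, hd.symm]
  rw [expCoeff, h]
  split_ifs with hk
  · rw [hk, Nat.factorial_zero, Nat.cast_one, one_mul, ← mul_assoc, factorial_mul_C_one_div,
      one_mul]
  · rw [mul_zero]

theorem coeff_add_pow_pairExponent (k l d : ℕ) :
    MvPowerSeries.coeff (pairExponent k l) ((xVar + yVar) ^ d) =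
      if k + l = d then (d.choose k : CoeffRing) else 0 := by
  have hterm : ∀ i, MvPowerSeries.coeff (pairExponent k l)
      (xVar ^ i * yVar ^ (d - i) * (d.choose i : SeriesRing)) =
      if k = i ∧ l = d - i then (d.choose i : CoeffRing) else 0 := by
    intro i
    rw [pow_mul_pow_eq_monomial, mul_comm, ← map_natCast (MvPowerSeries.C (σ := Fin 2)),
      MvPowerSeries.coeff_C_mul, MvPowerSeries.coeff_monomial]
    simp [pairExponent_eq_iff]
  rw [add_pow, map_sum]
  simp only [hterm]
  by_cases h : k + l = d
  · rw [if_pos h, Finset.sum_eq_single k]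
    · rw [if_pos ⟨rfl, by omega⟩]
    · intro i _ hi
      exact if_neg fun hki => hi hki.1.symm
    · intro hk
      exact absurd (Finset.mem_range.2 (by omega)) hk
  · rw [if_neg h]
    refine Finset.sum_eq_zero fun i hi => if_neg fun hki => h ?_
    have := Finset.mem_range.1 hi
    omega

theorem expCoeff_eta_xVar_add_yVar (k l : ℕ) :
    expCoeff (eta (xVar + yVar)) k l = if k + l = 0 then 0 else alphaVar ^ (k + l - 1) := by
  have h : MvPowerSeries.coeff (pairExponent k l) (eta (xVar + yVar)) =
      PowerSeries.coeff (k + l) etaSeries * ((k + l).choose k : CoeffRing) := by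
    rw [eta, PowerSeries.coeff_subst hasSubst_xVar_add_yVar, finsum_eq_single _ (k + l)]
    · simp [coeff_add_pow_pairExponent]
    · intro d hd
      simp [coeff_add_pow_pairExponent, hd.symm]
  rw [expCoeff, h, ← factorial_mul_coeff_etaSeries,
    ← Nat.choose_mul_factorial_mul_factorial (Nat.le_add_right k l), Nat.add_sub_cancel_left]
  push_cast
  ring

theorem isUnit_one_sub_tVar_mul_eta :
    IsUnit (1 - MvPowerSeries.C tVar * eta (xVar + yVar)) := by
  have h := expCoeff_eta_xVar_add_yVar 0 0
  have h0 : pairExponent 0 0 = 0 := by simp [pairExponent]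
  rw [expCoeff, h0] at h
  simp only [Nat.factorial_zero, Nat.cast_one, mul_one, one_mul, add_zero, if_true,
    MvPowerSeries.coeff_zero_eq_constantCoeff_apply] at h
  rw [MvPowerSeries.isUnit_iff_constantCoeff, map_sub, map_mul, h]
  simp

/-- The closed form of the generating function of the `f`-polynomials. -/
noncomputable def closedForm : SeriesRing :=
  expSeries (MvPowerSeries.C (alphaVar + tVar) * yVar) * eta xVar *
    Ring.inverse (1 - MvPowerSeries.C tVar * eta (xVar + yVar))

theorem expCoeff_closedForm_zero (l : ℕ) : expCoeff closedForm 0 l = 0 := by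
  -- With `eta xVar` as left factor, `k = 0` leaves only its coefficients free of `x`, which vanish.
  rw [closedForm, mul_comm (expSeries _), mul_assoc, expCoeff_mul]
  simp [expCoeff_eta_xVar]

theorem expCoeff_expSeries_mul_eta (c : CoeffRing) {k : ℕ} (hk : k ≠ 0) (l : ℕ) :
    expCoeff (expSeries (MvPowerSeries.C c * yVar) * eta xVar) k l =
      alphaVar ^ (k - 1) * c ^ l := by
  rw [expCoeff_mul, Finset.sum_eq_single 0, Finset.sum_eq_single l]
  · simp [expCoeff_expSeries, expCoeff_eta_xVar, hk, mul_comm (c ^ l)]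
  · intro q hq hql
    have : l - q ≠ 0 := by have := Finset.mem_range.1 hq; omega
    simp [expCoeff_eta_xVar, this]
  · simp
  · intro p _ hp
    simp [expCoeff_expSeries, hp]
  · simp

theorem closedForm_eq :
    closedForm = expSeries (MvPowerSeries.C (alphaVar + tVar) * yVar) * eta xVar +
      MvPowerSeries.C tVar * (eta (xVar + yVar) * closedForm) := by
  have h := (Ring.eq_mul_inverse_iff_mul_eq closedForm
    (expSeries (MvPowerSeries.C (alphaVar + tVar) * yVar) * eta xVar) _
    isUnit_one_sub_tVar_mul_eta).1 rfl
  rw [← h]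
  ring

/-- The bracket is the coefficient of `tP + e^{ty}`, with `P` the closed form. The part with `tP`
gives `t η(x+y) P`; the part with `e^{ty}` gives the inhomogeneous term of `closedForm_eq`. -/
theorem expCoeff_closedForm_recursion {k : ℕ} (hk : k ≠ 0) (l : ℕ) :
    tVar * expCoeff closedForm k l =
      ∑ p ∈ Finset.range (k + 1), ∑ q ∈ Finset.range (l + 1),
        (k.choose p : CoeffRing) * (l.choose q : CoeffRing) *
          if p + q = 0 then 0 else alphaVar ^ (p + q - 1) * tVar *
            (tVar * expCoeff closedForm (k - p) (l - q) +
              if k - p = 0 then tVar ^ (l - q) else 0) := by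
  have hsplit : ∀ p q : ℕ, (k.choose p : CoeffRing) * (l.choose q : CoeffRing) *
      (if p + q = 0 then 0 else alphaVar ^ (p + q - 1) * tVar *
        (tVar * expCoeff closedForm (k - p) (l - q) +
          if k - p = 0 then tVar ^ (l - q) else 0)) =
      tVar * (tVar * ((k.choose p : CoeffRing) * (l.choose q : CoeffRing) *
        (expCoeff (eta (xVar + yVar)) p q * expCoeff closedForm (k - p) (l - q)))) +
      if k - p = 0 then tVar * ((k.choose p : CoeffRing) * (l.choose q : CoeffRing) *
        (expCoeff (eta (xVar + yVar)) p q * tVar ^ (l - q))) else 0 := by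
    intro p q
    rw [expCoeff_eta_xVar_add_yVar]
    split_ifs <;> ring
  have hlast : ∑ p ∈ Finset.range (k + 1), ∑ q ∈ Finset.range (l + 1),
      (if k - p = 0 then tVar * ((k.choose p : CoeffRing) * (l.choose q : CoeffRing) *
        (expCoeff (eta (xVar + yVar)) p q * tVar ^ (l - q))) else 0) =
      tVar * (alphaVar ^ (k - 1) * (alphaVar + tVar) ^ l) := by
    -- Only `p = k` contributes, and the sum over `q` is the binomial expansion of `(α + t)^l`,
    -- since `k ≥ 1` lets `α^(k+q-1)` split as `α^(k-1) α^q`.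
    rw [Finset.sum_eq_single k]
    · rw [add_pow, Finset.mul_sum, Finset.mul_sum]
      refine Finset.sum_congr rfl fun q _ => ?_
      rw [if_pos (Nat.sub_self k), expCoeff_eta_xVar_add_yVar, if_neg (by omega),
        Nat.choose_self, show k + q - 1 = (k - 1) + q by omega, pow_add]
      push_cast
      ring
    · intro p hp hpk
      have : k - p ≠ 0 := by have := Finset.mem_range.1 hp; omega
      simp [this]
    · simp
  simp only [hsplit, Finset.sum_add_distrib, ← Finset.mul_sum]
  rw [hlast, ← expCoeff_mul, ← expCoeff_C_mul tVar (eta _ * _), ← mul_add, add_comm,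
    ← expCoeff_expSeries_mul_eta _ hk, ← expCoeff_add, ← closedForm_eq]

end Series

/-! ### From face polynomials to `f`-polynomials. -/

section Nestohedra

variable {V : Type*} [Fintype V] [DecidableEq V]

theorem faceSpan_le_of_univ_mem {B : Finset (Finset V)} (hB : Finset.univ ∈ B)
    (f : Finset V → Finset V) : faceSpan B f ≤ faceSpan B id :=
  iSup₂_le fun _ _ => (vectorSpan_mono ℝ (Set.image_mono (by simp))).trans
    (vectorSpan_le_faceSpan hB (C := Finset.univ) subset_rfl)

theorem polyDim_nestohedron (B : BuildingSet V) :
    polyDim (nestohedron B) = Module.finrank ℝ (faceSpan B.sets id) :=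
  polyDim_sum_simplexFace (T := id) B.nonempty_of_mem

theorem finrank_faceSpan_id {B : BuildingSet V} (hB : Finset.univ ∈ B.sets) :
    Module.finrank ℝ (faceSpan B.sets id) = Fintype.card V - 1 := by
  have h : faceSpan B.sets id =
      vectorSpan ℝ ((fun i : V => (Pi.single i 1 : V → ℝ)) '' ((Finset.univ : Finset V) : Set V)) :=
    le_antisymm (iSup₂_le fun _ _ => vectorSpan_mono ℝ (Set.image_mono (by simp)))
      (vectorSpan_le_faceSpan hB subset_rfl)
  rw [h, finrank_vectorSpan_single (B.nonempty_of_mem _ hB), Finset.card_univ]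

/-- As the whole vertex set is in `B`, the dimension is `|V| - 1`, so the weight exponent `|V| - d`
exceeds the codimension of the face by one. -/
theorem tVar_mul_fPolynomial_nestohedron {B : BuildingSet V} (hB : Finset.univ ∈ B.sets) :
    tVar * fPolynomial (nestohedron B) = facePolynomial B.sets Finset.univ := by
  have hdim : polyDim (nestohedron B) = Fintype.card V - 1 :=
    (polyDim_nestohedron B).trans (finrank_faceSpan_id hB)
  have hle : ∀ f : Finset V → Finset V,
      Module.finrank ℝ (faceSpan B.sets f) ≤ Fintype.card V - 1 := fun f =>
    (Submodule.finrank_mono (faceSpan_le_of_univ_mem hB f)).trans (finrank_faceSpan_id hB).le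
  have hpos : 0 < Fintype.card V := Finset.card_univ (α := V) ▸ (B.nonempty_of_mem _ hB).card_pos
  rw [fPolynomial, hdim, facePolynomial, ← Finset.sum_fiberwise_of_maps_to
    (t := Finset.range (Fintype.card V - 1 + 1))
    (fun f _ => Finset.mem_range_succ_iff.2 (hle f)), Finset.mul_sum]
  refine Finset.sum_congr rfl fun i hi => ?_
  have hi := Finset.mem_range_succ_iff.1 hi
  have hterm : ∀ f ∈ (choiceMaps B.sets Finset.univ).filter
      (fun f => Module.finrank ℝ (faceSpan B.sets f) = i),
      alphaVar ^ Module.finrank ℝ (faceSpan B.sets f) *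
        tVar ^ ((Finset.univ : Finset V).card - Module.finrank ℝ (faceSpan B.sets f)) =
      alphaVar ^ i * (tVar * tVar ^ (Fintype.card V - 1 - i)) := by
    intro f hf
    rw [(Finset.mem_filter.1 hf).2, Finset.card_univ, ← pow_succ']
    congr 2
    omega
  rw [Finset.sum_congr rfl hterm, Finset.sum_const, nsmul_eq_mul, faceCount_nestohedron]
  ring

end Nestohedra

/-! ### The join of a complete and an empty graph. -/

section CompleteEmpty

/-- The vertices of the complete part of the join. -/
def completePart (k l : ℕ) : Finset (Fin k ⊕ Fin l) :=
  Finset.univ.map Function.Embedding.inl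

/-- A vertex of the complete part is adjacent to every other vertex; a set without such a vertex
induces an edgeless graph, connected only on one point. -/
theorem mem_sets_completeEmpty {k l : ℕ} (S : Finset (Fin k ⊕ Fin l)) :
    S ∈ (graphicalBuildingSet
      (graphJoin (⊤ : SimpleGraph (Fin k)) (⊥ : SimpleGraph (Fin l)))).sets ↔
      S.card = 1 ∨ (S ∩ completePart k l).Nonempty := by
  set G := graphJoin (⊤ : SimpleGraph (Fin k)) (⊥ : SimpleGraph (Fin l)) with hG
  have hmem : S ∈ (graphicalBuildingSet G).sets ↔ (G.induce (S : Set _)).Connected := by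
    simp [graphicalBuildingSet]
  constructor
  · intro hS
    by_contra! hne
    have hconn := hmem.1 hS
    have hbot : G.induce (S : Set (Fin k ⊕ Fin l)) = ⊥ := by
      ext ⟨u, hu⟩ ⟨v, hv⟩
      have hK : ∀ a, Sum.inl a ∉ S := by
        intro a ha
        have : Sum.inl a ∈ S ∩ completePart k l := by simp [completePart, ha]
        simp [hne.2] at this
      rcases u with a | a
      · exact absurd hu (hK a)
      rcases v with b | b
      · exact absurd hv (hK b)
      simp [hG, graphJoin]
    rw [hbot, SimpleGraph.connected_bot_iff] at hconn
    obtain ⟨hsub, ⟨v⟩⟩ := hconn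
    refine hne.1 (Finset.card_eq_one.2 ⟨v, ?_⟩)
    ext u
    rw [Finset.mem_singleton]
    exact ⟨fun hu => congrArg Subtype.val (hsub.elim ⟨u, hu⟩ v), fun hu => hu ▸ v.2⟩
  · rintro (h | ⟨u, hu⟩)
    · obtain ⟨v, rfl⟩ := Finset.card_eq_one.1 h
      exact (graphicalBuildingSet G).singleton_mem v
    · obtain ⟨huS, hu⟩ := Finset.mem_inter.1 hu
      obtain ⟨a, -, rfl⟩ := Finset.mem_map.1 hu
      rw [hmem, SimpleGraph.connected_iff_exists_forall_reachable]
      refine ⟨⟨_, huS⟩, fun ⟨v, hv⟩ => ?_⟩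
      by_cases hav : Sum.inl a = v
      · subst hav
        exact SimpleGraph.Reachable.refl _
      · refine SimpleGraph.Adj.reachable ?_
        rcases v with b | b
        · have : a ≠ b := fun h => hav (h ▸ rfl)
          simp [hG, graphJoin, this]
        · simp [hG, graphJoin]

theorem fPolynomial_completeEmptyNestohedron {k : ℕ} (hk : k ≠ 0) (l : ℕ) :
    fPolynomial (completeEmptyNestohedron k l) = expCoeff closedForm k l := by
  have hK : (Finset.univ ∩ completePart k l).card = k := by simp [completePart]
  have hL : (Finset.univ \ completePart k l).card = l := by
    have h := Finset.card_inter_add_card_sdiff Finset.univ (completePart k l)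
    rw [hK, Finset.card_univ, Fintype.card_sum, Fintype.card_fin, Fintype.card_fin] at h
    omega
  have huniv : Finset.univ ∈ (graphicalBuildingSet
      (graphJoin (⊤ : SimpleGraph (Fin k)) (⊥ : SimpleGraph (Fin l)))).sets := by
    rw [mem_sets_completeEmpty, ← Finset.card_pos, hK]
    exact Or.inr (Nat.pos_of_ne_zero hk)
  have ht : tVar ≠ 0 := MvPolynomial.X_ne_zero 1
  refine mul_left_cancel₀ ht ?_
  rw [completeEmptyNestohedron, tVar_mul_fPolynomial_nestohedron huniv,
    facePolynomial_eq mem_sets_completeEmpty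
      -- These are the exponential coefficients of `tP + e^{ty}`; the second term supplies the face
      -- polynomials `t^l` of sets missing the complete part.
      (h := fun k l => tVar * expCoeff closedForm k l + if k = 0 then tVar ^ l else 0)
      (fun l => by simp [expCoeff_closedForm_zero])
      (fun k l hk => by rw [if_neg hk, add_zero, expCoeff_closedForm_recursion hk]),
    hK, hL, if_neg hk, add_zero]

theorem expCoeff_fGenFun {k : ℕ} (hk : k ≠ 0) (l : ℕ) :
    expCoeff fGenFun k l = fPolynomial (completeEmptyNestohedron k l) := by
  have h : MvPowerSeries.coeff (pairExponent k l) fGenFun =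
      MvPolynomial.C (1 / (k.factorial * l.factorial : ℚ)) *
        fPolynomial (completeEmptyNestohedron k l) := by
    have hm : ∀ m : Fin 2 →₀ ℕ, m 0 = k → m 1 = l → MvPowerSeries.coeff m fGenFun =
        MvPolynomial.C (1 / (k.factorial * l.factorial : ℚ)) *
          fPolynomial (completeEmptyNestohedron k l) := by
      rintro m rfl rfl
      exact if_neg hk
    exact hm _ (pairExponent_zero k l) (pairExponent_one k l)
  rw [expCoeff, h, one_div, mul_inv, map_mul, ← one_div, ← one_div]
  linear_combination (fPolynomial (completeEmptyNestohedron k l)) *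
    ((l.factorial : CoeffRing) * MvPolynomial.C (1 / (l.factorial : ℚ)) *
      factorial_mul_C_one_div k + factorial_mul_C_one_div l)

theorem expCoeff_fGenFun_zero (l : ℕ) : expCoeff fGenFun 0 l = 0 := by
  have h : MvPowerSeries.coeff (pairExponent 0 l) fGenFun = 0 := by
    rw [MvPowerSeries.coeff_apply, fGenFun]
    simp only [pairExponent_zero, if_true]
  rw [expCoeff, h, mul_zero]

theorem fGenFun_eq_closedForm : fGenFun = closedForm := by
  refine ext_of_expCoeff fun k l => ?_
  by_cases hk : k = 0
  · rw [hk, expCoeff_fGenFun_zero, expCoeff_closedForm_zero]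
  · rw [expCoeff_fGenFun hk, fPolynomial_completeEmptyNestohedron hk]

end CompleteEmpty

theorem mainTheorem5 :
    IsUnit (1 - MvPowerSeries.C tVar * eta (xVar + yVar)) ∧
      fGenFun =
        expSeries (MvPowerSeries.C (alphaVar + tVar) * yVar) * eta xVar *
          Ring.inverse (1 - MvPowerSeries.C tVar * eta (xVar + yVar)) :=
  ⟨isUnit_one_sub_tVar_mul_eta, fGenFun_eq_closedForm⟩
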